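/- **Theorem 2.2.** Let $c>0$, $T>0$, and let $u$ solve the initial-boundary value problem $$u_t=c\,u_{xx}\ \text{ on }(0,1)\times(0,T],\qquad u(x,0)=\varphi(x)\ (0\le x\le 1),\qquad u(0,t)=g_1(t),\ u(1,t)=g_2(t)\ (0<t\le T).$$ Assume that $u$ is $C^6$ in $x$ and $C^3$ in $t$: the partial derivatives $\partial_x^i u$ $(0\le i\le 6)$ and $\partial_t^i u$ $(0\le i\le 3)$ exist and are continuous on $[0,1]\times[0,T]$ (one-sided at the boundary). For positive integers $N,M$ put $h=1/N$, $\tau=T/M$, $x_j=jh$, $t_k=k\tau$, $x_{j+1/2}=(j+\tfrac12)h$. Let $(u_j^k)_{0\le j\le N,\,0\le k\le M}$ be a solution of the high-order compact difference (H-OCD) scheme $$(u^{k+1}_{j-1}-u^k_{j-1})+10(u^{k+1}_j-u^k_j)+(u^{k+1}_{j+1}-u^k_{j+1})=\frac{6c\tau}{h^2}\,\delta_x^2(u^k_j+u^{k+1}_j),\qquad 1\le j\le N-1,\ 0\le k\le M-1,$$ $$u^0_j=\varphi(x_j)\ (0\le j\le N),\qquad u^k_0=g_1(t_k),\quad u^k_N=g_2(t_k)\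 (0\le k\le M),$$ where $\delta_x^2 v_j=v_{j-1}-2v_j+v_{j+1}$. Define the collocation slopes $$P^k_j=\frac1{12h}\left[8u^k_{j+1}-8u^k_{j-1}+u^k_{j-2}-u^k_{j+2}\right],\qquad 2\le j\le N-2,$$ and the midpoint values of the cubic Hermite interpolant with these values and slopes, $$u^k_{j+1/2}=\tfrac12\,(u^k_j+u^k_{j+1})+\tfrac h8\,(P^k_j-P^k_{j+1}),\qquad 2\le j\le N-3.$$ Then there is a constant $C$, independent of $N$, $M$, $j$ and $k$, such that for all positive integers $N,M$ $$\left|u(x_{j+1/2},t_k)-u^k_{j+1/2}\right|\le C(\tau^2+h^4),\qquad 2\le j\le N-3,\ 0\le k\le M.$$ -/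

import Mathlib

namespace HOCD

noncomputable section

/-- The `n`-th partial derivative in space of `u` at `(x, t)`, for `x ∈ [0, 1]`
(one-sided at the two endpoints). -/
def partialX (n : ℕ) (u : ℝ → ℝ → ℝ) (x t : ℝ) : ℝ :=
  iteratedDerivWithin n (fun y => u y t) (Set.Icc 0 1) x

/-- The `n`-th partial derivative in time of `u` at `(x, t)`, for `t ∈ [0, T]`
(one-sided at the two endpoints). -/
def partialT (T : ℝ) (n : ℕ) (u : ℝ → ℝ → ℝ) (x t : ℝ) : ℝ :=
  iteratedDerivWithin n (fun s => u x s) (Set.Icc 0 T) t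

/-- `u` is of class `C^n` in space: the partial derivatives in `x` up to order `n` exist and are
(jointly) continuous on the closed rectangle `[0, 1] × [0, T]`. -/
structure IsContDiffX (T : ℝ) (n : ℕ) (u : ℝ → ℝ → ℝ) : Prop where
  contDiffOn : ∀ t ∈ Set.Icc (0 : ℝ) T,
    ContDiffOn ℝ (n : ℕ∞) (fun x => u x t) (Set.Icc 0 1)
  continuousOn : ∀ i ≤ n,
    ContinuousOn (fun p : ℝ × ℝ => partialX i u p.1 p.2) (Set.Icc 0 1 ×ˢ Set.Icc 0 T)

/-- `u` is of class `C^n` in time: the partial derivatives in `t` up to order `n` exist and are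
(jointly) continuous on the closed rectangle `[0, 1] × [0, T]`. -/
structure IsContDiffT (T : ℝ) (n : ℕ) (u : ℝ → ℝ → ℝ) : Prop where
  contDiffOn : ∀ x ∈ Set.Icc (0 : ℝ) 1,
    ContDiffOn ℝ (n : ℕ∞) (fun t => u x t) (Set.Icc 0 T)
  continuousOn : ∀ i ≤ n,
    ContinuousOn (fun p : ℝ × ℝ => partialT T i u p.1 p.2) (Set.Icc 0 1 ×ˢ Set.Icc 0 T)

/-- `u` solves the heat equation `u_t = c u_xx` on `(0, 1) × (0, T]` with initial value `φ` and
Dirichlet boundary values `g₁`, `g₂`. (The differentiability that gives the equation its meaning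
is the one of `IsContDiffX` and `IsContDiffT`.) -/
structure IsHeatSolution (c T : ℝ) (φ g₁ g₂ : ℝ → ℝ) (u : ℝ → ℝ → ℝ) : Prop where
  heat : ∀ x ∈ Set.Ioo (0 : ℝ) 1, ∀ t ∈ Set.Ioc (0 : ℝ) T,
    partialT T 1 u x t = c * partialX 2 u x t
  initial : ∀ x ∈ Set.Icc (0 : ℝ) 1, u x 0 = φ x
  left : ∀ t ∈ Set.Ioc (0 : ℝ) T, u 0 t = g₁ t
  right : ∀ t ∈ Set.Ioc (0 : ℝ) T, u 1 t = g₂ t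

/-- The space step `h = 1 / N`. -/
def spaceStep (N : ℕ) : ℝ := 1 / (N : ℝ)

/-- The time step `τ = T / M`. -/
def timeStep (T : ℝ) (M : ℕ) : ℝ := T / (M : ℝ)

/-- The second central difference `v_{j-1} - 2 v_j + v_{j+1}` (used for `j ≥ 1` only). -/
def secondDiff (v : ℕ → ℝ) (j : ℕ) : ℝ := v (j - 1) - 2 * v j + v (j + 1)

/-- `U k j` (for `0 ≤ k ≤ M`, `0 ≤ j ≤ N`) is a solution of the high-order compact difference
scheme with space step `1 / N` and time step `T / M`. -/
structure IsSolution (c T : ℝ) (φ g₁ g₂ : ℝ → ℝ) (N M : ℕ) (U : ℕ → ℕ → ℝ) : Prop where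
  scheme : ∀ k < M, ∀ j, 1 ≤ j → j < N →
    (U (k + 1) (j - 1) - U k (j - 1)) + 10 * (U (k + 1) j - U k j)
        + (U (k + 1) (j + 1) - U k (j + 1))
      = 6 * c * timeStep T M / spaceStep N ^ 2 * secondDiff (fun i => U k i + U (k + 1) i) j
  initial : ∀ j ≤ N, U 0 j = φ (j * spaceStep N)
  left : ∀ k ≤ M, U k 0 = g₁ (k * timeStep T M)
  right : ∀ k ≤ M, U k N = g₂ (k * timeStep T M)

/-- The numerical gradient at the interior grid point `x_j`, `2 ≤ j ≤ N - 2`, that the collocation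
polynomial yields from the grid values `v` with space step `h`:
`P_j = (8 v_{j+1} - 8 v_{j-1} + v_{j-2} - v_{j+2}) / (12 h)`. -/
def slope (h : ℝ) (v : ℕ → ℝ) (j : ℕ) : ℝ :=
  1 / (12 * h) * (8 * v (j + 1) - 8 * v (j - 1) + v (j - 2) - v (j + 2))

/-- The value at the midpoint of `[x_j, x_{j+1}]` of the cubic Hermite interpolant with values
`v_j`, `v_{j+1}` and slopes `P_j`, `P_{j+1}` at the endpoints. -/
def midValue (h : ℝ) (v : ℕ → ℝ) (j : ℕ) : ℝ :=
  1 / 2 * (v j + v (j + 1)) + h / 8 * (slope h v j - slope h v (j + 1))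

end

end HOCD

/-! The grid error `u - U` solves the scheme with zero data and a residual, so consistency and
stability suffice.

Consistency (`abs_residual_le`): the trapezoidal rule in time, `u_t = c u_xx`, and the Numerov
identity for the weights 1, 10, 1 bound the residual by a multiple of `τ (τ² + h⁴)`.

Stability (`abs_le_of_residual`): test the error equation with the time increment of the error.
Summation by parts turns diffusion into a difference of discrete `H¹` energies, and the weights 1,
10, 1 dominate `8 ∑ d²`, which absorbs the residual. A discrete Sobolev inequality then gives the
maximum norm.

The midpoint value is a fixed six-point average, bounded in the maximum norm and exact on cubics, so
the grid order carries over. -/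

namespace HOCD

open Set hiding range
open Finset (range)

/-! ### Taylor estimates -/

/-- A crude Taylor estimate for a chain `f 0, f 1, …` of successive derivatives on a convex set. -/
lemma abs_sub_taylor_le {I : Set ℝ} (hI : Convex ℝ I) {B : ℝ} (n : ℕ) (f : ℕ → ℝ → ℝ)
    (hf : ∀ i ≤ n, ∀ x ∈ I, HasDerivWithinAt (f i) (f (i + 1) x) I x)
    (hB : ∀ x ∈ I, |f (n + 1) x| ≤ B) {x y : ℝ} (hx : x ∈ I) (hy : y ∈ I) :
    |f 0 y - ∑ i ∈ range (n + 1), f i x * (y - x) ^ i / (i.factorial : ℝ)|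
      ≤ B * |y - x| ^ (n + 1) := by
  induction n generalizing f y with
  | zero =>
    have := hI.norm_image_sub_le_of_norm_hasDerivWithin_le (f := f 0) (f' := f 1)
      (fun z hz => hf 0 le_rfl z hz) hB hx hy
    simpa using this
  | succ n ih =>
    have hsub : segment ℝ x y ⊆ I := hI.segment_subset hx hy
    -- The derivative of the remainder is the remainder of the shifted chain; the mean value
    -- inequality then gains one factor `|y - x|`, without the factorial.
    have hder : ∀ z ∈ segment ℝ x y, HasDerivWithinAt
        (fun z => f 0 z - ∑ i ∈ range (n + 2), f i x * (z - x) ^ i / (i.factorial : ℝ))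
        (f 1 z - ∑ i ∈ range (n + 1), f (i + 1) x * (z - x) ^ i / (i.factorial : ℝ))
        (segment ℝ x y) z := by
      intro z hz
      refine ((hf 0 (Nat.zero_le _) z (hsub hz)).mono hsub).sub ?_
      have hsum : HasDerivWithinAt
          (fun z => ∑ i ∈ range (n + 2), f i x * (z - x) ^ i / (i.factorial : ℝ))
          (∑ i ∈ range (n + 2), f i x * ((i : ℝ) * (z - x) ^ (i - 1) * 1) / (i.factorial : ℝ))
          (segment ℝ x y) z :=
        HasDerivWithinAt.fun_sum fun i _ =>
          ((((hasDerivWithinAt_id z _).sub_const x).pow i).const_mul (f i x)).div_const _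
      refine hsum.congr_deriv ?_
      rw [Finset.sum_range_succ']
      simp only [Nat.cast_zero, zero_mul, mul_zero, zero_div, add_zero, mul_one]
      refine Finset.sum_congr rfl fun i _ => ?_
      have : ((i : ℝ) + 1) ≠ 0 := by positivity
      have : (i.factorial : ℝ) ≠ 0 := by positivity
      rw [Nat.factorial_succ]
      push_cast
      field_simp
    have hbound : ∀ z ∈ segment ℝ x y,
        ‖f 1 z - ∑ i ∈ range (n + 1), f (i + 1) x * (z - x) ^ i / (i.factorial : ℝ)‖
          ≤ B * |y - x| ^ (n + 1) := by
      intro z hz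
      have h0 : 0 ≤ B := (abs_nonneg _).trans (hB x hx)
      refine (ih (fun i => f (i + 1)) (fun i hi => hf (i + 1) (by omega)) hB (hsub hz)).trans ?_
      have hzx : |z - x| ≤ |y - x| := by
        rw [segment_eq_uIcc] at hz
        exact abs_sub_left_of_mem_uIcc hz
      gcongr
    have := (convex_segment x y).norm_image_sub_le_of_norm_hasDerivWithin_le hder hbound
      (left_mem_segment ℝ x y) (right_mem_segment ℝ x y)
    have hxx : f 0 x - ∑ i ∈ range (n + 2), f i x * (x - x) ^ i / (i.factorial : ℝ) = 0 := by
      rw [Finset.sum_range_succ']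
      simp
    simp only [hxx, sub_zero, Real.norm_eq_abs] at this
    rw [pow_succ |y - x| (n + 1), ← mul_assoc]
    exact this

lemma hasDerivWithinAt_iteratedDerivWithin {a b : ℝ} (hab : a < b) {g : ℝ → ℝ} {n i : ℕ}
    (hg : ContDiffOn ℝ (n : ℕ∞) g (Icc a b)) (hi : i < n) {x : ℝ} (hx : x ∈ Icc a b) :
    HasDerivWithinAt (iteratedDerivWithin i g (Icc a b))
      (iteratedDerivWithin (i + 1) g (Icc a b) x) (Icc a b) x := by
  rw [iteratedDerivWithin_succ]
  exact ((hg.differentiableOn_iteratedDerivWithin (by exact_mod_cast hi)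
    (uniqueDiffOn_Icc hab)) x hx).hasDerivWithinAt

/-- Taylor's estimate around `x` for the `m`-th derivative. -/
lemma abs_iteratedDerivWithin_sub_taylor_le {a b : ℝ} (hab : a < b) {g : ℝ → ℝ} {B : ℝ} (m n : ℕ)
    (hg : ContDiffOn ℝ ((m + n + 1 : ℕ) : ℕ∞) g (Icc a b))
    (hB : ∀ x ∈ Icc a b, |iteratedDerivWithin (m + n + 1) g (Icc a b) x| ≤ B)
    {x y : ℝ} (hx : x ∈ Icc a b) (hy : y ∈ Icc a b) :
    |iteratedDerivWithin m g (Icc a b) y - ∑ i ∈ range (n + 1),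
        iteratedDerivWithin (m + i) g (Icc a b) x * (y - x) ^ i / (i.factorial : ℝ)|
      ≤ B * |y - x| ^ (n + 1) :=
  abs_sub_taylor_le (convex_Icc a b) n (fun i => iteratedDerivWithin (m + i) g (Icc a b))
    (fun _ hi _ hz => hasDerivWithinAt_iteratedDerivWithin hab hg (by omega) hz) hB hx hy

/-- The error of the trapezoidal rule for the derivative. -/
lemma abs_trapezoid_le {a b : ℝ} (hab : a < b) {g : ℝ → ℝ} {B : ℝ}
    (hg : ContDiffOn ℝ ((3 : ℕ) : ℕ∞) g (Icc a b))
    (hB : ∀ x ∈ Icc a b, |iteratedDerivWithin 3 g (Icc a b) x| ≤ B)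
    {s τ : ℝ} (hτ : 0 ≤ τ) (hs : s ∈ Icc a b) (hs' : s + τ ∈ Icc a b) :
    |g (s + τ) - g s - τ / 2 * (iteratedDerivWithin 1 g (Icc a b) s
        + iteratedDerivWithin 1 g (Icc a b) (s + τ))| ≤ 2 * B * τ ^ 3 := by
  have h0 := abs_iteratedDerivWithin_sub_taylor_le hab 0 2 hg hB hs hs'
  have h1 := abs_iteratedDerivWithin_sub_taylor_le hab 1 1 hg hB hs hs'
  simp only [Finset.sum_range_succ, Finset.sum_range_zero, iteratedDerivWithin_zero, Nat.factorial,
    add_sub_cancel_left, abs_of_nonneg hτ] at h0 h1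
  norm_num at h0 h1
  rw [iteratedDerivWithin_one]
  rw [abs_le] at h0 h1 ⊢
  have hBτ : 0 ≤ B * τ ^ 3 := mul_nonneg ((abs_nonneg _).trans (hB s hs)) (by positivity)
  have h1l := mul_le_mul_of_nonneg_left h1.1 hτ
  have h1u := mul_le_mul_of_nonneg_left h1.2 hτ
  constructor <;> nlinarith

/-- The error of the compact (Numerov) approximation of the second derivative. -/
lemma abs_compact_le {a b : ℝ} (hab : a < b) {g : ℝ → ℝ} {B : ℝ}
    (hg : ContDiffOn ℝ ((6 : ℕ) : ℕ∞) g (Icc a b))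
    (hB : ∀ x ∈ Icc a b, |iteratedDerivWithin 6 g (Icc a b) x| ≤ B)
    {x h : ℝ} (hh : 0 < h) (hx : x ∈ Icc a b) (hl : x - h ∈ Icc a b) (hr : x + h ∈ Icc a b) :
    |iteratedDerivWithin 2 g (Icc a b) (x - h) + 10 * iteratedDerivWithin 2 g (Icc a b) x
        + iteratedDerivWithin 2 g (Icc a b) (x + h)
        - 12 / h ^ 2 * (g (x - h) - 2 * g x + g (x + h))| ≤ 26 * B * h ^ 4 := by
  have l0 := abs_iteratedDerivWithin_sub_taylor_le hab 0 5 hg hB hx hl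
  have r0 := abs_iteratedDerivWithin_sub_taylor_le hab 0 5 hg hB hx hr
  have l2 := abs_iteratedDerivWithin_sub_taylor_le hab 2 3 hg hB hx hl
  have r2 := abs_iteratedDerivWithin_sub_taylor_le hab 2 3 hg hB hx hr
  have e1 : x - h - x = -h := by ring
  simp only [Finset.sum_range_succ, Finset.sum_range_zero, iteratedDerivWithin_zero, Nat.factorial,
    add_sub_cancel_left, e1, abs_neg, abs_of_pos hh] at l0 r0 l2 r2
  norm_num at l0 r0 l2 r2
  have hh2 : 0 < h ^ 2 := by positivity
  rw [← mul_le_mul_iff_left₀ hh2, ← abs_of_pos hh2, ← abs_mul, abs_of_pos hh2]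
  have key : (iteratedDerivWithin 2 g (Icc a b) (x - h) + 10 * iteratedDerivWithin 2 g (Icc a b) x
        + iteratedDerivWithin 2 g (Icc a b) (x + h)
        - 12 / h ^ 2 * (g (x - h) - 2 * g x + g (x + h))) * h ^ 2
      = h ^ 2 * (iteratedDerivWithin 2 g (Icc a b) (x - h)
        + 10 * iteratedDerivWithin 2 g (Icc a b) x
        + iteratedDerivWithin 2 g (Icc a b) (x + h)) - 12 * (g (x - h) - 2 * g x + g (x + h)) := by
    field_simp
  rw [key]
  rw [abs_le] at l0 r0 l2 r2 ⊢
  have a1 := mul_le_mul_of_nonneg_left l2.1 hh2.le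
  have a2 := mul_le_mul_of_nonneg_left l2.2 hh2.le
  have a3 := mul_le_mul_of_nonneg_left r2.1 hh2.le
  have a4 := mul_le_mul_of_nonneg_left r2.2 hh2.le
  -- 26 = 2 + 12 · 2: two remainders of the second derivative and, with weight 12, two of `g`.
  constructor <;> linarith

/-! ### The midpoint values -/

/-- The step cancels, leaving symmetric weights that serve both the stability and the accuracy
bound. -/
lemma midValue_eq {h : ℝ} (hh : h ≠ 0) (v : ℕ → ℝ) {j : ℕ} (hj : 2 ≤ j) :
    midValue h v j = (56 * (v j + v (j + 1)) - 9 * (v (j - 1) + v (j + 2))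
      + (v (j - 2) + v (j + 3))) / 96 := by
  obtain ⟨i, rfl⟩ := Nat.exists_eq_add_of_le' hj
  simp only [midValue, slope, Nat.add_sub_cancel, show i + 2 - 1 = i + 1 by omega,
    show i + 2 + 1 - 1 = i + 2 by omega, show i + 2 + 1 - 2 = i + 1 by omega, add_assoc,
    Nat.reduceAdd]
  field_simp
  ring

lemma midValue_sub (h : ℝ) (v w : ℕ → ℝ) (j : ℕ) :
    midValue h (fun i => v i - w i) j = midValue h v j - midValue h w j := by
  simp only [midValue, slope]
  ring

/-- The absolute weights sum to 132/96 < 2. -/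
lemma abs_midValue_le {h : ℝ} (hh : h ≠ 0) {v : ℕ → ℝ} {E : ℝ} {j : ℕ} (hj : 2 ≤ j)
    (hv : ∀ i ≤ j + 3, |v i| ≤ E) : |midValue h v j| ≤ 2 * E := by
  rw [midValue_eq hh v hj]
  have h0 := abs_le.1 (hv (j - 2) (by omega))
  have h1 := abs_le.1 (hv (j - 1) (by omega))
  have h2 := abs_le.1 (hv j (by omega))
  have h3 := abs_le.1 (hv (j + 1) (by omega))
  have h4 := abs_le.1 (hv (j + 2) (by omega))
  have h5 := abs_le.1 (hv (j + 3) (by omega))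
  rw [abs_le]
  constructor <;> linarith

/-- In Taylor expansions about the midpoint, odd terms cancel by symmetry and quadratic ones because
56 - 9 · 9 + 25 = 0. -/
lemma abs_sub_midValue_le {g : ℝ → ℝ} {B h : ℝ}
    (hg : ContDiffOn ℝ ((4 : ℕ) : ℕ∞) g (Icc 0 1))
    (hB : ∀ x ∈ Icc (0 : ℝ) 1, |iteratedDerivWithin 4 g (Icc 0 1) x| ≤ B)
    (hh : 0 < h) {j : ℕ} (hj : 2 ≤ j) (hjh : ((j : ℝ) + 3) * h ≤ 1) :
    |g (((j : ℝ) + 1 / 2) * h) - midValue h (fun i => g (i * h)) j| ≤ 3 * B * h ^ 4 := by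
  rw [midValue_eq hh.ne' _ hj]
  have hj' : (2 : ℝ) ≤ j := by exact_mod_cast hj
  have hjm : 0 ≤ ((j : ℝ) - 2) * h := mul_nonneg (by linarith) hh.le
  set x := ((j : ℝ) + 1 / 2) * h with hx
  have hx0 : 5 / 2 * h ≤ x := by rw [hx]; nlinarith
  have hx1 : x + 5 / 2 * h ≤ 1 := by rw [hx]; linarith
  have pt : ∀ q : ℝ, |q| ≤ 5 / 2 → |g (x + q * h) - ∑ i ∈ range 4,
      iteratedDerivWithin (0 + i) g (Icc 0 1) x * (q * h) ^ i / (i.factorial : ℝ)|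
        ≤ B * |q * h| ^ 4 := by
    intro q hq
    rw [abs_le] at hq
    have := abs_iteratedDerivWithin_sub_taylor_le (zero_lt_one' ℝ) 0 3 hg hB
      (x := x) (y := x + q * h) ⟨by linarith, by linarith⟩
      ⟨by nlinarith, by nlinarith⟩
    simpa only [add_sub_cancel_left, iteratedDerivWithin_zero] using this
  have hc2 : ((j - 2 : ℕ) : ℝ) = j - 2 := by rw [Nat.cast_sub hj]; norm_num
  have hc1 : ((j - 1 : ℕ) : ℝ) = j - 1 := by rw [Nat.cast_sub (by omega)]; norm_num
  have p1 := pt (-5 / 2) (by norm_num [abs_le])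
  have p2 := pt (-3 / 2) (by norm_num [abs_le])
  have p3 := pt (-1 / 2) (by norm_num [abs_le])
  have p4 := pt (1 / 2) (by norm_num [abs_le])
  have p5 := pt (3 / 2) (by norm_num [abs_le])
  have p6 := pt (5 / 2) (by norm_num [abs_le])
  have q1 : ((j - 2 : ℕ) : ℝ) * h = x + -5 / 2 * h := by rw [hc2]; ring
  have q2 : ((j - 1 : ℕ) : ℝ) * h = x + -3 / 2 * h := by rw [hc1]; ring
  have q3 : (j : ℝ) * h = x + -1 / 2 * h := by ring
  have q4 : ((j + 1 : ℕ) : ℝ) * h = x + 1 / 2 * h := by push_cast; ring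
  have q5 : ((j + 2 : ℕ) : ℝ) * h = x + 3 / 2 * h := by push_cast; ring
  have q6 : ((j + 3 : ℕ) : ℝ) * h = x + 5 / 2 * h := by push_cast; ring
  simp only [q1, q2, q3, q4, q5, q6]
  simp only [Even.pow_abs (show Even 4 by decide), Finset.sum_range_succ, Finset.sum_range_zero,
    Nat.factorial, zero_add, iteratedDerivWithin_zero] at p1 p2 p3 p4 p5 p6
  norm_num at p1 p2 p3 p4 p5 p6
  have hBh : 0 ≤ B * h ^ 4 := mul_nonneg ((abs_nonneg _).trans (hB x ⟨by linarith, by linarith⟩))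
    (by positivity)
  rw [abs_le] at p1 p2 p3 p4 p5 p6 ⊢
  norm_num
  constructor <;> linarith

/-! ### Stability of the scheme -/

lemma sum_secondDiff_mul (s d : ℕ → ℝ) (n : ℕ) (h0 : d 0 = 0) (hn : d (n + 1) = 0) :
    ∑ i ∈ range n, (s i - 2 * s (i + 1) + s (i + 2)) * d (i + 1)
      = -∑ i ∈ range (n + 1), (s (i + 1) - s i) * (d (i + 1) - d i) := by
  have key : ∀ m : ℕ, ∑ i ∈ range m, (s i - 2 * s (i + 1) + s (i + 2)) * d (i + 1)
      = (s (m + 1) - s m) * d (m + 1) - (s 1 - s 0) * d 0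
        - ∑ i ∈ range (m + 1), (s (i + 1) - s i) * (d (i + 1) - d i) := by
    intro m
    induction m with
    | zero => simp; ring
    | succ m ih =>
      rw [Finset.sum_range_succ, ih, Finset.sum_range_succ _ (m + 1)]
      ring
  rw [key, h0, hn]
  ring

/-- Diagonal dominance: the two neighbours cost at most 2 of the weight 10. -/
lemma eight_mul_sum_sq_le (d : ℕ → ℝ) (n : ℕ) (h0 : d 0 = 0) (hn : d (n + 1) = 0) :
    8 * ∑ i ∈ range n, d (i + 1) ^ 2
      ≤ ∑ i ∈ range n, (d i + 10 * d (i + 1) + d (i + 2)) * d (i + 1) := by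
  have key : ∀ m : ℕ, 8 * ∑ i ∈ range m, d (i + 1) ^ 2 + d m ^ 2 / 2
      ≤ ∑ i ∈ range m, (d i + 10 * d (i + 1) + d (i + 2)) * d (i + 1)
        + d 0 ^ 2 / 2 + (d (m + 1) ^ 2 - d 1 ^ 2) / 2 := by
    intro m
    induction m with
    | zero => simp
    | succ m ih =>
      rw [Finset.sum_range_succ, Finset.sum_range_succ]
      nlinarith [sq_nonneg (d m + d (m + 1)), sq_nonneg (d (m + 1) + d (m + 2))]
  have := key n
  rw [h0, hn] at this
  nlinarith [sq_nonneg (d n), sq_nonneg (d 1)]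

/-- The squared discrete `H¹` seminorm (up to scaling) of a grid function on `0, …, n`. -/
def energy (n : ℕ) (e : ℕ → ℝ) : ℝ := ∑ i ∈ range n, (e (i + 1) - e i) ^ 2

lemma energy_step {n : ℕ} {e e' r : ℕ → ℝ} {l ρ : ℝ} (h0 : e 0 = 0) (hn : e (n + 1) = 0)
    (h0' : e' 0 = 0) (hn' : e' (n + 1) = 0)
    (heq : ∀ i < n, (e' i - e i) + 10 * (e' (i + 1) - e (i + 1)) + (e' (i + 2) - e (i + 2))
      = l * ((e i + e' i) - 2 * (e (i + 1) + e' (i + 1)) + (e (i + 2) + e' (i + 2))) + r i)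
    (hr : ∀ i < n, |r i| ≤ ρ) :
    l * energy (n + 1) e' ≤ l * energy (n + 1) e + n * ρ ^ 2 / 32 := by
  have h1 := eight_mul_sum_sq_le (fun i => e' i - e i) n (by simp [h0, h0']) (by simp [hn, hn'])
  have h2 := sum_secondDiff_mul (fun i => e i + e' i) (fun i => e' i - e i) n (by simp [h0, h0'])
    (by simp [hn, hn'])
  have h3 : ∑ i ∈ range (n + 1), ((e (i + 1) + e' (i + 1)) - (e i + e' i))
      * ((e' (i + 1) - e (i + 1)) - (e' i - e i)) = energy (n + 1) e' - energy (n + 1) e := by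
    rw [energy, energy, ← Finset.sum_sub_distrib]
    exact Finset.sum_congr rfl fun i _ => by ring
  have h4 : ∑ i ∈ range n, ((e' i - e i) + 10 * (e' (i + 1) - e (i + 1)) + (e' (i + 2) - e (i + 2)))
        * (e' (i + 1) - e (i + 1))
      ≤ ∑ i ∈ range n, (l * (((e i + e' i) - 2 * (e (i + 1) + e' (i + 1))
          + (e (i + 2) + e' (i + 2))) * (e' (i + 1) - e (i + 1)))
        + 8 * (e' (i + 1) - e (i + 1)) ^ 2 + ρ ^ 2 / 32) := by
    refine Finset.sum_le_sum fun i hi => ?_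
    rw [heq i (Finset.mem_range.1 hi)]
    have hri : r i ^ 2 ≤ ρ ^ 2 := sq_le_sq' (abs_le.1 (hr i (Finset.mem_range.1 hi))).1
      (abs_le.1 (hr i (Finset.mem_range.1 hi))).2
    -- Young's inequality `r d ≤ 8 d² + r² / 32`, tuned to the 8 of `eight_mul_sum_sq_le`.
    nlinarith [sq_nonneg (r i - 16 * (e' (i + 1) - e (i + 1)))]
  rw [Finset.sum_add_distrib, Finset.sum_add_distrib, ← Finset.mul_sum, ← Finset.mul_sum, h2, h3,
    Finset.sum_const, Finset.card_range, nsmul_eq_mul] at h4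
  linarith

/-- Telescope from the zero boundary value and apply Cauchy–Schwarz. -/
lemma sq_le_mul_energy {n : ℕ} {e : ℕ → ℝ} (h0 : e 0 = 0) {j : ℕ} (hj : j ≤ n) :
    e j ^ 2 ≤ n * energy n e := by
  have h1 : e j = ∑ i ∈ range j, (e (i + 1) - e i) := by rw [Finset.sum_range_sub, h0, sub_zero]
  have h2 := sq_sum_le_card_mul_sum_sq (s := range j) (f := fun i => e (i + 1) - e i)
  rw [Finset.card_range] at h2
  have h3 : ∑ i ∈ range j, (e (i + 1) - e i) ^ 2 ≤ energy n e :=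
    Finset.sum_le_sum_of_subset_of_nonneg (Finset.range_subset_range.2 hj)
      fun _ _ _ => sq_nonneg _
  have h4 : (0 : ℝ) ≤ ∑ i ∈ range j, (e (i + 1) - e i) ^ 2 :=
    Finset.sum_nonneg fun _ _ => sq_nonneg _
  rw [h1]
  refine h2.trans ?_
  gcongr

/-- Stability of the compact scheme: a grid function with zero initial and boundary values and
residual at most `τ * σ` is bounded by a multiple of `σ`, without a condition on the mesh ratio. -/
lemma abs_le_of_residual {c T σ : ℝ} (hc : 0 < c) (hT : 0 < T) (hσ : 0 ≤ σ) {n M : ℕ} (hM : 0 < M)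
    {e r : ℕ → ℕ → ℝ} (hinit : ∀ j ≤ n + 1, e 0 j = 0) (hleft : ∀ k ≤ M, e k 0 = 0)
    (hright : ∀ k ≤ M, e k (n + 1) = 0)
    (heq : ∀ k < M, ∀ i < n, (e (k + 1) i - e k i) + 10 * (e (k + 1) (i + 1) - e k (i + 1))
        + (e (k + 1) (i + 2) - e k (i + 2))
      = 6 * c * timeStep T M / spaceStep (n + 1) ^ 2 * ((e k i + e (k + 1) i)
        - 2 * (e k (i + 1) + e (k + 1) (i + 1)) + (e k (i + 2) + e (k + 1) (i + 2))) + r k i)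
    (hr : ∀ k < M, ∀ i < n, |r k i| ≤ timeStep T M * σ) {k j : ℕ} (hk : k ≤ M) (hj : j ≤ n + 1) :
    |e k j| ≤ √(T / (192 * c)) * σ := by
  have hM' : (0 : ℝ) < M := by exact_mod_cast hM
  have hτ : 0 < timeStep T M := div_pos hT hM'
  have hh : spaceStep (n + 1) = 1 / ((n : ℝ) + 1) := by simp [spaceStep]
  have hMτ : (M : ℝ) * timeStep T M = T := by rw [timeStep]; field_simp
  set τ := timeStep T M
  have hn : (0 : ℝ) < (n : ℝ) + 1 := by positivity
  have hl : 6 * c * τ / spaceStep (n + 1) ^ 2 = 6 * c * τ * ((n : ℝ) + 1) ^ 2 := by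
    rw [hh]; field_simp
  rw [hl] at heq
  -- The factor `1 / (n + 1)` offsets the loss in `sq_le_mul_energy`, and `M * τ = T` bounds the
  -- accumulation in time.
  have hE : ∀ k ≤ M, energy (n + 1) (e k)
      ≤ k * (τ * σ ^ 2 / (192 * c * ((n : ℝ) + 1))) := by
    intro k
    induction k with
    | zero =>
      intro _
      rw [energy, Finset.sum_eq_zero]
      · simp
      · intro i hi
        rw [Finset.mem_range] at hi
        rw [hinit i (by omega), hinit (i + 1) (by omega)]
        simp
    | succ k ih =>
      intro hk
      have hs := energy_step (hleft k (by omega)) (hright k (by omega)) (hleft _ hk) (hright _ hk)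
        (heq k (by omega)) (hr k (by omega))
      have hle : (n : ℝ) * (τ * σ) ^ 2 / 32 ≤ 6 * c * τ * ((n : ℝ) + 1) ^ 2
          * (τ * σ ^ 2 / (192 * c * ((n : ℝ) + 1))) := by
        have : 6 * c * τ * ((n : ℝ) + 1) ^ 2 * (τ * σ ^ 2 / (192 * c * ((n : ℝ) + 1)))
            = ((n : ℝ) + 1) * (τ * σ) ^ 2 / 32 := by
          field_simp
          ring
        rw [this]
        gcongr
        linarith
      have hpos : 0 < 6 * c * τ * ((n : ℝ) + 1) ^ 2 := by positivity
      have : energy (n + 1) (e (k + 1)) ≤ energy (n + 1) (e k)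
          + τ * σ ^ 2 / (192 * c * ((n : ℝ) + 1)) := by
        refine le_of_mul_le_mul_left ?_ hpos
        linarith
      push_cast
      linarith [ih (by omega)]
  have h1 := sq_le_mul_energy (hleft k hk) hj
  have h2 : (((n + 1 : ℕ) : ℝ)) * energy (n + 1) (e k) ≤ T / (192 * c) * σ ^ 2 := by
    push_cast
    calc ((n : ℝ) + 1) * energy (n + 1) (e k)
        ≤ ((n : ℝ) + 1) * (M * (τ * σ ^ 2 / (192 * c * ((n : ℝ) + 1)))) := by
          have hkM : (k : ℝ) ≤ M := by exact_mod_cast hk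
          have := hE k hk
          gcongr
          refine this.trans ?_
          gcongr
      _ = M * τ / (192 * c) * σ ^ 2 := by field_simp
      _ = _ := by rw [hMτ]
  refine abs_le_of_sq_le_sq ?_ (by positivity)
  rw [mul_pow, Real.sq_sqrt (by positivity)]
  exact h1.trans h2

/-! ### Consistency of the scheme -/

lemma exists_abs_le {T : ℝ} {f : ℝ × ℝ → ℝ} (hf : ContinuousOn f (Icc 0 1 ×ˢ Icc 0 T)) :
    ∃ B : ℝ, 0 ≤ B ∧ ∀ x ∈ Icc (0 : ℝ) 1, ∀ t ∈ Icc (0 : ℝ) T, |f (x, t)| ≤ B := by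
  obtain ⟨B, hB⟩ := (isCompact_Icc.prod isCompact_Icc).exists_bound_of_continuousOn hf
  exact ⟨max B 0, le_max_right _ _, fun x hx t ht => (hB (x, t) ⟨hx, ht⟩).trans (le_max_left _ _)⟩

/-- By continuity the heat equation holds up to the parabolic boundary. -/
lemma IsHeatSolution.heat_closed {c T : ℝ} (hT : 0 < T) {φ g₁ g₂ : ℝ → ℝ} {u : ℝ → ℝ → ℝ}
    (hu : IsHeatSolution c T φ g₁ g₂ u) (hux : IsContDiffX T 6 u) (hut : IsContDiffT T 3 u)
    {x t : ℝ} (hx : x ∈ Icc (0 : ℝ) 1) (ht : t ∈ Icc (0 : ℝ) T) :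
    partialT T 1 u x t = c * partialX 2 u x t := by
  have key : EqOn (fun p : ℝ × ℝ => partialT T 1 u p.1 p.2)
      (fun p : ℝ × ℝ => c * partialX 2 u p.1 p.2) (Icc 0 1 ×ˢ Icc 0 T) := by
    refine EqOn.of_subset_closure (s := Ioo 0 1 ×ˢ Ioc 0 T)
      (fun p hp => hu.heat p.1 hp.1 p.2 hp.2)
      (hut.continuousOn 1 (by norm_num))
      ((hux.continuousOn 2 (by norm_num)).const_mul c)
      (Set.prod_mono Ioo_subset_Icc_self Ioc_subset_Icc_self) ?_
    rw [closure_prod_eq, closure_Ioo (by norm_num), closure_Ioc hT.ne]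
  exact key (Set.mk_mem_prod hx ht)

/-- The truncation error of the scheme. -/
lemma abs_residual_le {c T : ℝ} (hc : 0 < c) (hT : 0 < T) {φ g₁ g₂ : ℝ → ℝ} {u : ℝ → ℝ → ℝ}
    (hux : IsContDiffX T 6 u) (hut : IsContDiffT T 3 u) (hu : IsHeatSolution c T φ g₁ g₂ u)
    {B B' : ℝ} (hB : ∀ x ∈ Icc (0 : ℝ) 1, ∀ t ∈ Icc (0 : ℝ) T, |partialX 6 u x t| ≤ B)
    (hB' : ∀ x ∈ Icc (0 : ℝ) 1, ∀ t ∈ Icc (0 : ℝ) T, |partialT T 3 u x t| ≤ B')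
    {x t h τ : ℝ} (hh : 0 < h) (hτ : 0 < τ) (hl : 0 ≤ x - h) (hr : x + h ≤ 1) (ht : 0 ≤ t)
    (ht' : t + τ ≤ T) :
    |(u (x - h) (t + τ) - u (x - h) t) + 10 * (u x (t + τ) - u x t)
        + (u (x + h) (t + τ) - u (x + h) t)
        - 6 * c * τ / h ^ 2 * ((u (x - h) t + u (x - h) (t + τ)) - 2 * (u x t + u x (t + τ))
          + (u (x + h) t + u (x + h) (t + τ)))|
      ≤ τ * (24 * B' * τ ^ 2 + 26 * c * B * h ^ 4) := by
  have hxl : x - h ∈ Icc (0 : ℝ) 1 := ⟨hl, by linarith⟩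
  have hxm : x ∈ Icc (0 : ℝ) 1 := ⟨by linarith, by linarith⟩
  have hxr : x + h ∈ Icc (0 : ℝ) 1 := ⟨by linarith, hr⟩
  have htl : t ∈ Icc (0 : ℝ) T := ⟨ht, by linarith⟩
  have htr : t + τ ∈ Icc (0 : ℝ) T := ⟨by linarith, ht'⟩
  have time : ∀ y ∈ Icc (0 : ℝ) 1, |u y (t + τ) - u y t
      - τ / 2 * (c * partialX 2 u y t + c * partialX 2 u y (t + τ))| ≤ 2 * B' * τ ^ 3 := by
    intro y hy
    -- The closed form is needed since `y` may be a boundary node and `t` may be 0.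
    rw [← hu.heat_closed hT hux hut hy htl, ← hu.heat_closed hT hux hut hy htr]
    exact abs_trapezoid_le hT (hut.contDiffOn y hy) (hB' y hy) hτ.le htl htr
  have space : ∀ s ∈ Icc (0 : ℝ) T, |partialX 2 u (x - h) s + 10 * partialX 2 u x s
      + partialX 2 u (x + h) s - 12 / h ^ 2 * (u (x - h) s - 2 * u x s + u (x + h) s)|
        ≤ 26 * B * h ^ 4 := fun s hs =>
    abs_compact_le (zero_lt_one' ℝ) (hux.contDiffOn s hs) (fun y hy => hB y hy s hs) hh hxm hxl hxr
  have a1 := abs_le.1 (time _ hxl)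
  have a2 := abs_le.1 (time _ hxm)
  have a3 := abs_le.1 (time _ hxr)
  have hpos : 0 ≤ τ * c / 2 := by positivity
  have b1 := abs_le.1 (space _ htl)
  have b2 := abs_le.1 (space _ htr)
  have b1l := mul_le_mul_of_nonneg_left b1.1 hpos
  have b1u := mul_le_mul_of_nonneg_left b1.2 hpos
  have b2l := mul_le_mul_of_nonneg_left b2.1 hpos
  have b2u := mul_le_mul_of_nonneg_left b2.2 hpos
  have hdiv : 6 * c * τ / h ^ 2 = τ * c / 2 * (12 / h ^ 2) := by ring
  rw [hdiv, abs_le]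
  -- 24 = 2 · (1 + 10 + 1) from the time errors; the two space errors, each weighted by `τ * c / 2`,
  -- give 26.
  constructor <;> linarith

lemma natCast_mul_timeStep_mem {T : ℝ} (hT : 0 < T) {M k : ℕ} (hM : 0 < M) (hk : k ≤ M) :
    (k : ℝ) * timeStep T M ∈ Icc (0 : ℝ) T := by
  have hM' : (0 : ℝ) < M := by exact_mod_cast hM
  have hk' : (k : ℝ) ≤ M := by exact_mod_cast hk
  rw [timeStep]
  refine ⟨by positivity, ?_⟩
  rw [← mul_div_assoc, div_le_iff₀ hM', mul_comm T]
  gcongr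

lemma natCast_mul_spaceStep_le {N j : ℕ} (hN : 0 < N) (hj : j ≤ N) :
    (j : ℝ) * spaceStep N ≤ 1 := by
  have hN' : (0 : ℝ) < N := by exact_mod_cast hN
  have hj' : (j : ℝ) ≤ N := by exact_mod_cast hj
  rw [spaceStep, mul_one_div, div_le_one hN']
  exact hj'

/-- Convergence of the scheme at the grid points. -/
lemma exists_abs_sub_le {c T : ℝ} (hc : 0 < c) (hT : 0 < T) {φ g₁ g₂ : ℝ → ℝ} {u : ℝ → ℝ → ℝ}
    (hux : IsContDiffX T 6 u) (hut : IsContDiffT T 3 u) (hu : IsHeatSolution c T φ g₁ g₂ u) :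
    ∃ K : ℝ, 0 ≤ K ∧ ∀ N M : ℕ, 0 < N → 0 < M → ∀ U : ℕ → ℕ → ℝ, IsSolution c T φ g₁ g₂ N M U →
      ∀ j ≤ N, ∀ k ≤ M, |u (j * spaceStep N) (k * timeStep T M) - U k j|
        ≤ K * (timeStep T M ^ 2 + spaceStep N ^ 4) := by
  obtain ⟨B, hB0, hB⟩ := exists_abs_le (hux.continuousOn 6 le_rfl)
  obtain ⟨B', hB0', hB'⟩ := exists_abs_le (hut.continuousOn 3 le_rfl)
  refine ⟨√(T / (192 * c)) * (24 * B' + 26 * c * B), by positivity, ?_⟩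
  intro N M hN hM U hU j hj k hk
  obtain ⟨n, rfl⟩ : ∃ n, N = n + 1 := ⟨N - 1, by omega⟩
  have hM' : (0 : ℝ) < M := by exact_mod_cast hM
  have hτ : 0 < timeStep T M := div_pos hT hM'
  have hh : 0 < spaceStep (n + 1) := by rw [spaceStep]; positivity
  have hmem : ∀ i ≤ n + 1, (i : ℝ) * spaceStep (n + 1) ∈ Icc (0 : ℝ) 1 := fun i hi =>
    ⟨by positivity, natCast_mul_spaceStep_le hN hi⟩
  have hend : ((n + 1 : ℕ) : ℝ) * spaceStep (n + 1) = 1 := by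
    rw [spaceStep, mul_one_div, div_self (by positivity)]
  have hinit : ∀ i ≤ n + 1, u (i * spaceStep (n + 1)) ((0 : ℕ) * timeStep T M) - U 0 i = 0 := by
    intro i hi
    rw [hU.initial i hi, Nat.cast_zero, zero_mul, hu.initial _ (hmem i hi), sub_self]
  have htime : ∀ k ≤ M, k ≠ 0 → (k : ℝ) * timeStep T M ∈ Ioc (0 : ℝ) T := fun k hk hk0 =>
    ⟨by have : (0 : ℝ) < k := by exact_mod_cast Nat.pos_of_ne_zero hk0
        positivity, (natCast_mul_timeStep_mem hT hM hk).2⟩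
  rw [mul_assoc]
  refine abs_le_of_residual hc hT (by positivity) hM
    (e := fun k j => u (j * spaceStep (n + 1)) (k * timeStep T M) - U k j)
    (r := fun k i => (u (i * spaceStep (n + 1)) ((k + 1 : ℕ) * timeStep T M)
          - u (i * spaceStep (n + 1)) (k * timeStep T M))
        + 10 * (u ((i + 1 : ℕ) * spaceStep (n + 1)) ((k + 1 : ℕ) * timeStep T M)
          - u ((i + 1 : ℕ) * spaceStep (n + 1)) (k * timeStep T M))
        + (u ((i + 2 : ℕ) * spaceStep (n + 1)) ((k + 1 : ℕ) * timeStep T M)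
          - u ((i + 2 : ℕ) * spaceStep (n + 1)) (k * timeStep T M))
        - 6 * c * timeStep T M / spaceStep (n + 1) ^ 2
          * ((u (i * spaceStep (n + 1)) (k * timeStep T M)
              + u (i * spaceStep (n + 1)) ((k + 1 : ℕ) * timeStep T M))
            - 2 * (u ((i + 1 : ℕ) * spaceStep (n + 1)) (k * timeStep T M)
              + u ((i + 1 : ℕ) * spaceStep (n + 1)) ((k + 1 : ℕ) * timeStep T M))
            + (u ((i + 2 : ℕ) * spaceStep (n + 1)) (k * timeStep T M)
              + u ((i + 2 : ℕ) * spaceStep (n + 1)) ((k + 1 : ℕ) * timeStep T M))))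
    hinit ?_ ?_ ?_ ?_ hk hj
  · intro k hk
    -- `u` matches `g₁` only for positive times; at time 0 the initial data take over.
    rcases eq_or_ne k 0 with rfl | hk0
    · exact hinit 0 (by omega)
    · simp only [hU.left k hk, Nat.cast_zero, zero_mul, hu.left _ (htime k hk hk0), sub_self]
  · intro k hk
    rcases eq_or_ne k 0 with rfl | hk0
    · exact hinit (n + 1) le_rfl
    · simp only [hU.right k hk, hend, hu.right _ (htime k hk hk0), sub_self]
  · intro k hk i hi
    have := hU.scheme k hk (i + 1) (by omega) (by omega)
    simp only [secondDiff, Nat.add_sub_cancel, add_assoc, Nat.reduceAdd] at this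
    linear_combination -this
  · intro k hk i hi
    have e0 : (i : ℝ) * spaceStep (n + 1)
        = ((i + 1 : ℕ) : ℝ) * spaceStep (n + 1) - spaceStep (n + 1) := by push_cast; ring
    have e2 : ((i + 2 : ℕ) : ℝ) * spaceStep (n + 1)
        = ((i + 1 : ℕ) : ℝ) * spaceStep (n + 1) + spaceStep (n + 1) := by push_cast; ring
    have e3 : ((k + 1 : ℕ) : ℝ) * timeStep T M = k * timeStep T M + timeStep T M := by
      push_cast; ring
    have m0 := hmem i (by omega)
    have m2 := hmem (i + 2) (by omega)
    have m3 := natCast_mul_timeStep_mem hT hM (show k + 1 ≤ M by omega)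
    rw [e0] at m0
    rw [e2] at m2
    rw [e3] at m3
    simp only [e0, e2, e3]
    refine (abs_residual_le hc hT hux hut hu hB hB' hh hτ m0.1 m2.2
      (natCast_mul_timeStep_mem hT hM hk.le).1 m3.2).trans ?_
    gcongr
    have : 0 ≤ 24 * B' * spaceStep (n + 1) ^ 4 := by positivity
    have : 0 ≤ 26 * c * B * timeStep T M ^ 2 := by positivity
    linarith

end HOCD

theorem theorem2p2 (c T : ℝ) (hc : 0 < c) (hT : 0 < T) (φ g₁ g₂ : ℝ → ℝ) (u : ℝ → ℝ → ℝ)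
    (hux : HOCD.IsContDiffX T 6 u) (hut : HOCD.IsContDiffT T 3 u)
    (hu : HOCD.IsHeatSolution c T φ g₁ g₂ u) :
    ∃ C : ℝ, ∀ N M : ℕ, 0 < N → 0 < M →
      ∀ U : ℕ → ℕ → ℝ, HOCD.IsSolution c T φ g₁ g₂ N M U →
        ∀ j : ℕ, 2 ≤ j → j + 3 ≤ N → ∀ k ≤ M,
          |u (((j : ℝ) + 1 / 2) * HOCD.spaceStep N) (k * HOCD.timeStep T M)
              - HOCD.midValue (HOCD.spaceStep N) (U k) j|
            ≤ C * (HOCD.timeStep T M ^ 2 + HOCD.spaceStep N ^ 4) := by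
  obtain ⟨K, hK0, hK⟩ := HOCD.exists_abs_sub_le hc hT hux hut hu
  obtain ⟨B, hB0, hB⟩ := HOCD.exists_abs_le (hux.continuousOn 4 (by norm_num))
  -- `2 * K` is the grid error passed through the midpoint average, `3 * B` the interpolation error
  -- of `u` itself.
  refine ⟨2 * K + 3 * B, fun N M hN hM U hU j hj hjN k hk => ?_⟩
  have ht := HOCD.natCast_mul_timeStep_mem hT hM hk
  have hh : 0 < HOCD.spaceStep N := by
    have : (0 : ℝ) < N := by exact_mod_cast hN
    rw [HOCD.spaceStep]; positivity
  have hjh : ((j : ℝ) + 3) * HOCD.spaceStep N ≤ 1 := by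
    exact_mod_cast HOCD.natCast_mul_spaceStep_le hN hjN
  have h1 := HOCD.abs_sub_midValue_le ((hux.contDiffOn _ ht).of_le (by norm_num))
    (fun x hx => hB x hx _ ht) hh hj hjh
  have h2 := HOCD.abs_midValue_le hh.ne' hj
    (fun i hi => hK N M hN hM U hU i (hi.trans hjN) k hk)
  rw [HOCD.midValue_sub] at h2
  refine (abs_sub_le _ (HOCD.midValue (HOCD.spaceStep N)
    (fun i => u (i * HOCD.spaceStep N) (k * HOCD.timeStep T M)) j) _).trans ?_
  have : 0 ≤ 3 * B * HOCD.timeStep T M ^ 2 := by positivity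
  linarith
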